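/- **Model.** An instance of fully online matching is a finite simple graph $G=(V,E)$ (not necessarily bipartite) together with an order of $2|V|$ events: an arrival and a deadline for every vertex, such that each vertex and all its neighbors arrive before its deadline. An edge is revealed when both its endpoints have arrived, and it may be matched fractionally until the first deadline of its endpoints. A fractional matching is $x\in\mathbb{R}_{\ge 0}^{E}$ whose water levels $x_u:=\sum_{v:(u,v)\in E}x_{uv}$ are at most $1$ for all $u\in V$; its size is $\sum_{e\in E}x_e$. A deterministic fractional online algorithm is $\Gamma$-competitive if on every instance it outputs a fractional matching of size at least $\Gamma$ times the maximum size of a fractional matching of $G$ (hence also at least $\Gamma$ times the size of a maximum matching of $G$). **Algorithm.** For an increasing function $f:[0,1]\to[0,1]$ with $f(0)=0$ and $f(1)=1$, *Eager Water-filling* starts with $x=0$ and processes the events in order; at a step of a vertex $u$ only the neighbors of $u$ that have arrived and whose deadlines have not passed are available. 1. On the arrival of $u$, match $u$ continuously to its available neighbor $v$ of lowest water level (raising tied neighbors together) as long as $f(x_u)+f(x_v)\le 1$ and neither vertex is full; the process ends when $f(x_u)+f(x_v)\ge 1$ for every available neighbor $v$. 2. At the deadline of $u$, match $u$ continuously to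 its available neighbor $v$ of lowest water level (raising tied neighbors together) until $x_u=1$ or $x_v=1$ for every available neighbor $v$. **Theorem.** There is a continuous, strictly increasing function $h:[0,1]\to[0,1]$ with $h(0)=0$ and $h(1)=1$ such that, with $f=h^{-1}$, Eager Water-filling is a well-defined deterministic fractional algorithm (it has exactly one output on every instance) and is $0.592$-competitive for fractional fully online matching on general graphs. -/

import Mathlib

universe u

namespace FullyOnline

/-- The two kinds of steps of a fully online matching instance. -/
inductive Event (V : Type u) : Type u
  | arrival (v : V) : Event V
  | deadline (v : V) : Event V

/-- An instance of fully online matching: a finite simple (not necessarily bipartite) graph on `V`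
and an order of its `2|V|` events, one arrival and one deadline for every vertex, such that every
vertex and all of its neighbors arrive before the deadline of that vertex. -/
structure Instance (V : Type u) [Fintype V] where
  graph : SimpleGraph V
  event : Fin (2 * Fintype.card V) ≃ Event V
  arrival_lt_deadline : ∀ v, event.symm (.arrival v) < event.symm (.deadline v)
  neighbor_arrival_lt_deadline : ∀ v w, graph.Adj v w →
    event.symm (.arrival w) < event.symm (.deadline v)

section Matching

variable {V : Type u} [Fintype V]

open Classical in
/-- The water level of `v` : the total fraction of `v` matched so far, where `x e` is the fraction
to which the edge `e` is matched. -/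
noncomputable def level (G : SimpleGraph V) (x : Sym2 V → ℝ) (v : V) : ℝ :=
  ∑ w with G.Adj v w, x s(v, w)

open Classical in
/-- The size of a fractional matching. -/
noncomputable def size (G : SimpleGraph V) (x : Sym2 V → ℝ) : ℝ :=
  ∑ e ∈ G.edgeFinset, x e

/-- Feasible points of the matching linear program of `G`. Only the values on edges matter. -/
def IsFractionalMatching (G : SimpleGraph V) (x : Sym2 V → ℝ) : Prop :=
  (∀ e ∈ G.edgeSet, 0 ≤ x e) ∧ ∀ v, level G x v ≤ 1

/-- The continuous process that transforms `x` into `x'` by matching the active vertex `u` to its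
candidate neighbors (those in `C`). It is a path `y` on a time interval `[0, T]`, with an arbitrary
parametrization, along which all edge fractions are continuous and nondecreasing. Whenever an edge
is being increased immediately after time `s`, this edge joins `u` to a candidate `v` which at
time `s` has the lowest water level among all candidates, and the water levels of `u` and `v` at
time `s` satisfy the condition `allowed` (so tied candidates are raised together). -/
def ContinuouslyMatches (G : SimpleGraph V) (u : V) (C : Set V) (allowed : ℝ → ℝ → Prop)
    (x x' : Sym2 V → ℝ) : Prop :=
  ∃ (T : ℝ) (y : ℝ → Sym2 V → ℝ), 0 ≤ T ∧ y 0 = x ∧ y T = x' ∧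
    (∀ e, ContinuousOn (fun s => y s e) (Set.Icc 0 T)) ∧
    (∀ e, MonotoneOn (fun s => y s e) (Set.Icc 0 T)) ∧
    ∀ s ∈ Set.Ico 0 T, ∀ e, (∀ t ∈ Set.Ioc s T, y s e < y t e) →
      ∃ v ∈ C, e = s(u, v) ∧ (∀ w ∈ C, level G (y s) v ≤ level G (y s) w) ∧
        allowed (level G (y s) u) (level G (y s) v)

namespace Instance

/-- The neighbors of `u` that have arrived before step `i` and whose deadline is after step `i`. -/
def available (I : Instance V) (i : Fin (2 * Fintype.card V)) (u : V) : Set V :=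
  {v | I.graph.Adj u v ∧ I.event.symm (.arrival v) < i ∧ i < I.event.symm (.deadline v)}

/-- Arrival of `u` at step `i` : as long as `f (x_u) + f (x_v) ≤ 1` for the available neighbor `v`
of lowest water level (and neither vertex is full), `u` is matched to it; the continuous process
ends when no available neighbor has `f (x_u) + f (x_v) < 1` any more. -/
def ArrivalStep (I : Instance V) (f : ℝ → ℝ) (i : Fin (2 * Fintype.card V)) (u : V)
    (x x' : Sym2 V → ℝ) : Prop :=
  ContinuouslyMatches I.graph u (I.available i u)
    (fun a b => a < 1 ∧ b < 1 ∧ f a + f b ≤ 1) x x' ∧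
  ∀ v ∈ I.available i u, 1 ≤ f (level I.graph x' u) + f (level I.graph x' v)

/-- Deadline of `u` at step `i` : `u` is matched to the available neighbor of lowest water level
until `u` is full or all its available neighbors are full. -/
def DeadlineStep (I : Instance V) (i : Fin (2 * Fintype.card V)) (u : V)
    (x x' : Sym2 V → ℝ) : Prop :=
  ContinuouslyMatches I.graph u (I.available i u) (fun a b => a < 1 ∧ b < 1) x x' ∧
  (level I.graph x' u = 1 ∨ ∀ v ∈ I.available i u, level I.graph x' v = 1)

/-- One step of Eager Water-filling. -/
def EagerStep (I : Instance V) (f : ℝ → ℝ) (i : Fin (2 * Fintype.card V))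
    (x x' : Sym2 V → ℝ) : Prop :=
  match I.event i with
  | .arrival u => I.ArrivalStep f i u x x'
  | .deadline u => I.DeadlineStep i u x x'

/-- `x` is the outcome of Eager Water-filling with function `f` on the instance `I` : starting from
the zero matching, the events are processed one after another. -/
def IsEagerOutput (I : Instance V) (f : ℝ → ℝ) (x : Sym2 V → ℝ) : Prop :=
  ∃ X : Fin (2 * Fintype.card V + 1) → Sym2 V → ℝ,
    X 0 = 0 ∧ (∀ i, I.EagerStep f i (X i.castSucc) (X i.succ)) ∧ X (Fin.last _) = x

end Instance

end Matching

/-- Eager Water-filling with function `f` is a well-defined deterministic algorithm (on every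
instance it has exactly one outcome), its outcome is always a fractional matching, and the size of
the outcome is at least `Γ` times that of every fractional matching of the graph (in particular,
of every integral one). -/
def EagerWaterFillingIsCompetitive (f : ℝ → ℝ) (Γ : ℝ) : Prop :=
  ∀ (V : Type u) [Fintype V] (I : Instance V),
    (∃! x, I.IsEagerOutput f x) ∧
    ∀ x, I.IsEagerOutput f x →
      IsFractionalMatching I.graph x ∧
      ∀ z, IsFractionalMatching I.graph z → Γ * size I.graph z ≤ size I.graph x

end FullyOnline

/-! The proof is primal-dual. Every matched amount is split between the active vertex and the
candidate `v`: the candidate earns at rate `f (x_v)`, hence the increment of a primitive `F` of `f`,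
and the active vertex earns the rest, at rate `1 - f (x_v)`. The shares `α` add up to the size of
the matching, so by weak duality (`mul_size_le_of_cover`) it suffices that `Γ ≤ α v + α w` on every
edge.

Let `a v` be the level of `v` right after its arrival. Edges raised on arrival end with `f + f ≤ 1`,
so `v` earns at least `f (a v)` per unit then, and the increments of `F` afterwards. Consider the
first deadline on an edge, that of `v`. If the neighbor `w` is full afterwards, `Γ ≤ F 1` suffices.
Otherwise `v` is full; if `p` is its level before the step and `b` that of `w` after it, the step
adds at least `(1 - p) * (1 - f b)` to `α v`. The arrival rule also leaves `1 ≤ f + f` on the edge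
when its later endpoint arrives; the two orders of arrival lead to `le_earlier` and `le_later` of
`GainSharing`. `DualInvariant` carries the bookkeeping.

With `h` the inverse of `f` and `H` its primitive, Young's identity `a * f a - F a = H (f a)` turns
these conditions into inequalities between prices. For the piecewise linear `waterLevel` they are
quadratic on each piece (`earlier_bound`, `later_bound`).

Each step has an outcome by explicit water-filling (`fill`), and only one by comparing two outcomes
(`MatchedTo.le_of_halt`). -/

namespace FullyOnline

/-! ### Water levels, double counting and weak duality -/

section Levels

variable {V : Type u} [Fintype V] {G : SimpleGraph V} {x x' : Sym2 V → ℝ}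

open Classical in
theorem level_eq_sum_edges (G : SimpleGraph V) (x : Sym2 V → ℝ) (v : V) :
    level G x v = ∑ e ∈ G.edgeFinset, if v ∈ e then x e else 0 := by
  rw [← Finset.sum_filter]
  have h : G.edgeFinset.filter (v ∈ ·) =
      (Finset.univ.filter (G.Adj v)).image (fun w => s(v, w)) := by
    ext e
    induction e with | _ a b =>
    simp only [Finset.mem_filter, SimpleGraph.mem_edgeFinset, SimpleGraph.mem_edgeSet,
      Sym2.mem_iff, Finset.mem_image, Finset.mem_univ, true_and]
    constructor
    · rintro ⟨hab, rfl | rfl⟩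
      · exact ⟨b, hab, rfl⟩
      · exact ⟨a, hab.symm, Sym2.eq_swap⟩
    · rintro ⟨w, hw, he⟩
      rcases Sym2.eq_iff.1 he with ⟨rfl, rfl⟩ | ⟨rfl, rfl⟩
      · exact ⟨hw, Or.inl rfl⟩
      · exact ⟨hw.symm, Or.inr rfl⟩
  rw [h, Finset.sum_image (fun a _ b _ hab => Sym2.congr_right.1 hab), level]

open Classical in
theorem sum_mul_level (G : SimpleGraph V) (x : Sym2 V → ℝ) (α : V → ℝ) :
    ∑ v, α v * level G x v = ∑ e ∈ G.edgeFinset, x e * ∑ v, if v ∈ e then α v else 0 := by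
  simp_rw [level_eq_sum_edges, Finset.mul_sum]
  rw [Finset.sum_comm]
  refine Finset.sum_congr rfl fun e _ => Finset.sum_congr rfl fun v _ => ?_
  split_ifs <;> ring

open Classical in
theorem sum_ends_of_adj {v w : V} (h : G.Adj v w) (α : V → ℝ) :
    (∑ a, if a ∈ s(v, w) then α a else 0) = α v + α w := by
  have : ∀ a, (if a ∈ s(v, w) then α a else 0) =
      (if a = v then α a else 0) + (if a = w then α a else 0) := by
    intro a
    by_cases h1 : a = v
    · subst h1
      simp [h.ne]
    · simp [h1]
  rw [Finset.sum_congr rfl fun a _ => this a]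
  simp [Finset.sum_add_distrib]

theorem sum_level (G : SimpleGraph V) (x : Sym2 V → ℝ) : ∑ v, level G x v = 2 * size G x := by
  classical
  have h := sum_mul_level G x (fun _ => 1)
  simp only [one_mul] at h
  rw [h, size, Finset.mul_sum]
  refine Finset.sum_congr (by congr) fun e he => ?_
  induction e with | _ a b =>
  rw [SimpleGraph.mem_edgeFinset, SimpleGraph.mem_edgeSet] at he
  rw [sum_ends_of_adj he]
  ring

/-- Weak duality for the fractional matching linear program. -/
theorem mul_size_le_of_cover {Γ : ℝ} {α : V → ℝ} (hα : ∀ v, 0 ≤ α v)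
    (hcov : ∀ v w, G.Adj v w → Γ ≤ α v + α w) {z : Sym2 V → ℝ} (hz : IsFractionalMatching G z) :
    Γ * size G z ≤ ∑ v, α v := by
  classical
  calc Γ * size G z ≤ ∑ v, α v * level G z v := by
        rw [sum_mul_level, size, Finset.mul_sum]
        refine (Finset.sum_le_sum fun e he => ?_).trans_eq (Finset.sum_congr (by congr) fun _ _ => rfl)
        induction e with | _ a b =>
        rw [SimpleGraph.mem_edgeFinset] at he
        have hab : G.Adj a b := he
        rw [sum_ends_of_adj hab, mul_comm]
        exact mul_le_mul_of_nonneg_left (hcov a b hab) (hz.1 _ he)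
    _ ≤ ∑ v, α v := Finset.sum_le_sum fun v _ => mul_le_of_le_one_right (hα v) (hz.2 v)

theorem level_nonneg (hx : ∀ e, 0 ≤ x e) (v : V) : 0 ≤ level G x v :=
  Finset.sum_nonneg fun _ _ => hx _

theorem level_mono (hx : ∀ e, x e ≤ x' e) (v : V) : level G x v ≤ level G x' v :=
  Finset.sum_le_sum fun _ _ => hx _

/-- `x` and `x'` differ at most on edges that join `u` to `C`. -/
def AgreeOff (u : V) (C : Set V) (x x' : Sym2 V → ℝ) : Prop :=
  ∀ e, (∀ v ∈ C, e ≠ s(u, v)) → x' e = x e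

variable {u : V} {C : Set V}

theorem AgreeOff.level_candidate (h : AgreeOff u C x x') (hC : ∀ v ∈ C, G.Adj u v) {v : V}
    (hv : v ∈ C) : level G x' v - level G x v = x' s(u, v) - x s(u, v) := by
  classical
  rw [level, level, ← Finset.sum_sub_distrib, Finset.sum_eq_single u]
  · rw [Sym2.eq_swap]
  · intro w _ hw
    rw [h, sub_self]
    intro a ha he
    rcases Sym2.eq_iff.1 he with ⟨h1, -⟩ | ⟨-, h2⟩
    · exact (hC v hv).ne h1.symm
    · exact hw h2
  · intro hu
    exact absurd (Finset.mem_filter.2 ⟨Finset.mem_univ _, (hC v hv).symm⟩) hu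

open Classical in
theorem AgreeOff.level_active (h : AgreeOff u C x x') (hC : ∀ v ∈ C, G.Adj u v) :
    level G x' u - level G x u = ∑ v with v ∈ C, (level G x' v - level G x v) := by
  rw [level, level, ← Finset.sum_sub_distrib]
  symm
  trans ∑ v with v ∈ C, (x' s(u, v) - x s(u, v))
  · exact Finset.sum_congr rfl fun v hv => h.level_candidate hC (Finset.mem_filter.1 hv).2
  refine Finset.sum_subset ?_ ?_
  · intro v hv
    exact Finset.mem_filter.2 ⟨Finset.mem_univ _, hC v (Finset.mem_filter.1 hv).2⟩
  · intro v _ hv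
    rw [h, sub_self]
    intro a ha he
    rw [Sym2.congr_right] at he
    exact hv (Finset.mem_filter.2 ⟨Finset.mem_univ _, he ▸ ha⟩)

theorem AgreeOff.level_other (h : AgreeOff u C x x') {v : V} (hv : v ∉ C) (hu : v ≠ u) :
    level G x' v = level G x v := by
  classical
  refine Finset.sum_congr rfl fun w _ => h _ fun a ha he => ?_
  rcases Sym2.eq_iff.1 he with ⟨h1, -⟩ | ⟨h1, -⟩
  · exact hu h1
  · exact hv (h1 ▸ ha)

-- The levels sum to twice the size, and the active vertex rises by exactly as much as its
-- candidates together.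
open Classical in
theorem AgreeOff.size_eq (h : AgreeOff u C x x') (hC : ∀ v ∈ C, G.Adj u v) :
    size G x' - size G x = ∑ v with v ∈ C, (level G x' v - level G x v) := by
  have hu : u ∉ Finset.univ.filter (· ∈ C) := fun hu => (hC u (Finset.mem_filter.1 hu).2).ne rfl
  have key : ∑ v, (level G x' v - level G x v) =
      ∑ v ∈ insert u (Finset.univ.filter (· ∈ C)), (level G x' v - level G x v) := by
    symm
    refine Finset.sum_subset (Finset.subset_univ _) fun v _ hv => ?_
    rw [Finset.mem_insert, not_or, Finset.mem_filter] at hv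
    rw [h.level_other (fun hC => hv.2 ⟨Finset.mem_univ _, hC⟩) hv.1, sub_self]
  rw [Finset.sum_insert hu, h.level_active hC, Finset.sum_sub_distrib, sum_level, sum_level] at key
  linarith

end Levels

/-! ### Outcomes of the continuous process and their uniqueness -/

section MatchingProcess

variable {V : Type u} [Fintype V] {G : SimpleGraph V} {x x' x₁ x₂ : Sym2 V → ℝ}
  {u : V} {C : Set V} {allowed : ℝ → ℝ → Prop}

/-- What is needed of the outcome `x'` of a continuous matching process: it only increases edges
between `u` and `C`; a candidate that was matched has the lowest level of all candidates; and the
levels of `u` and of a matched candidate are limits of allowed pairs. -/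
structure MatchedTo (G : SimpleGraph V) (u : V) (C : Set V) (allowed : ℝ → ℝ → Prop)
    (x x' : Sym2 V → ℝ) : Prop where
  agreeOff : AgreeOff u C x x'
  le : ∀ e, x e ≤ x' e
  lowest : ∀ v ∈ C, x s(u, v) < x' s(u, v) → ∀ w ∈ C, level G x' v ≤ level G x' w
  mem_closure : ∀ v ∈ C, x s(u, v) < x' s(u, v) →
    (level G x' u, level G x' v) ∈ closure {p : ℝ × ℝ | allowed p.1 p.2}

/-- A continuous monotone function takes each value below its final one for a last time. -/
theorem exists_last_time {T : ℝ} (hT : 0 ≤ T) {φ : ℝ → ℝ} (hc : ContinuousOn φ (Set.Icc 0 T))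
    (hm : MonotoneOn φ (Set.Icc 0 T)) {c : ℝ} (h0 : φ 0 ≤ c) (h1 : c < φ T) :
    ∃ s ∈ Set.Ico 0 T, φ s = c ∧ ∀ t ∈ Set.Ioc s T, φ s < φ t := by
  have hcomp : IsCompact (Set.Icc 0 T ∩ φ ⁻¹' Set.Iic c) :=
    isCompact_Icc.of_isClosed_subset (hc.preimage_isClosed_of_isClosed isClosed_Icc isClosed_Iic)
      Set.inter_subset_left
  obtain ⟨s, ⟨hs, hsc⟩, hmax⟩ := hcomp.exists_isGreatest ⟨0, ⟨le_rfl, hT⟩, h0⟩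
  obtain ⟨r, hr, hrc⟩ := intermediate_value_Icc hT hc ⟨h0, h1.le⟩
  have hrs : r ≤ s := hmax ⟨hr, hrc.le⟩
  have heq : φ s = c := le_antisymm hsc (hrc ▸ hm hr hs hrs)
  have hsT : s < T := lt_of_le_of_ne hs.2 (by rintro rfl; exact h1.ne heq.symm)
  refine ⟨s, ⟨hs.1, hsT⟩, heq, fun t ht => ?_⟩
  rw [heq]
  by_contra hle
  exact absurd (hmax ⟨⟨hs.1.trans ht.1.le, ht.2⟩, not_lt.1 hle⟩) (not_le.2 ht.1)

/-- An edge is increasing right after the last time it has a given value, so the rule applies at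
that time. Taking values close to the final one transfers the rule to the outcome in the limit. -/
theorem ContinuouslyMatches.matchedTo (hC : ∀ v ∈ C, G.Adj u v)
    (h : ContinuouslyMatches G u C allowed x x') : MatchedTo G u C allowed x x' := by
  classical
  obtain ⟨T, y, hT, rfl, rfl, hcont, hmono, hstep⟩ := h
  have h0T : (0 : ℝ) ∈ Set.Icc 0 T := ⟨le_rfl, hT⟩
  have hTT : T ∈ Set.Icc 0 T := ⟨hT, le_rfl⟩
  have hle : ∀ e, y 0 e ≤ y T e := fun e => hmono e h0T hTT hT
  have hagree : ∀ s ∈ Set.Icc 0 T, AgreeOff u C (y s) (y T) := by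
    intro s hs e he
    by_contra hne
    have hlt : y s e < y T e := lt_of_le_of_ne (hmono e hs hTT hs.2) (Ne.symm hne)
    obtain ⟨r, hr, -, hinc⟩ := exists_last_time hT (hcont e) (hmono e) (hmono e h0T hs hs.1) hlt
    obtain ⟨v, hv, hev, -⟩ := hstep r hr e hinc
    exact he v hv hev
  have htime : ∀ v ∈ C, ∀ c, y 0 s(u, v) ≤ c → c < y T s(u, v) → ∃ s ∈ Set.Icc 0 T,
      y s s(u, v) = c ∧ (∀ w ∈ C, level G (y s) v ≤ level G (y s) w) ∧
      allowed (level G (y s) u) (level G (y s) v) := by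
    intro v _ c h0 h1
    obtain ⟨s, hs, hsc, hinc⟩ := exists_last_time hT (hcont _) (hmono _) h0 h1
    obtain ⟨w, hw, he, hlow, hall⟩ := hstep s hs _ hinc
    rw [Sym2.congr_right] at he
    subst he
    exact ⟨s, ⟨hs.1, hs.2.le⟩, hsc, hlow, hall⟩
  have hlow : ∀ v ∈ C, y 0 s(u, v) < y T s(u, v) → ∀ w ∈ C, level G (y T) v ≤ level G (y T) w := by
    intro v hv hlt w hw
    refine le_of_forall_pos_le_add fun ε hε => ?_
    obtain ⟨s, hs, hsc, hmin, -⟩ := htime v hv (max (y 0 s(u, v)) (y T s(u, v) - ε))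
      (le_max_left _ _) (max_lt hlt (by linarith))
    have h1 := (hagree s hs).level_candidate hC hv
    have h2 := level_mono (G := G) (fun e => hmono e hs hTT hs.2) w
    have h3 := hmin w hw
    have h4 := le_max_right (y 0 s(u, v)) (y T s(u, v) - ε)
    linarith
  refine ⟨hagree 0 h0T, hle, hlow, fun v hv hlt => ?_⟩
  rw [Metric.mem_closure_iff]
  intro ε hε
  set n : ℝ := ((Finset.univ.filter (· ∈ C)).card : ℝ)
  have hn : 0 ≤ n := Nat.cast_nonneg _
  -- At most `n` candidates rise by at most `δ` each, so `u` rises by at most `n * δ < ε`.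
  set δ := ε / (n + 2)
  have hδ : 0 < δ := by positivity
  have hδε : (n + 2) * δ = ε := by simp only [δ]; field_simp
  obtain ⟨s, hs, hsc, hmin, hall⟩ := htime v hv (max (y 0 s(u, v)) (y T s(u, v) - δ))
    (le_max_left _ _) (max_lt hlt (by linarith))
  have hsδ := le_max_right (y 0 s(u, v)) (y T s(u, v) - δ)
  rw [← hsc] at hsδ
  have hv1 := (hagree s hs).level_candidate hC hv
  have hmonoT : ∀ e, y s e ≤ y T e := fun e => hmono e hs hTT hs.2
  -- A candidate `w` that still rises ends lowest, so not above `v`; at time `s` it was not below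
  -- `v`, which has at most `δ` left to rise.
  have hcand : ∀ w ∈ C, level G (y T) w - level G (y s) w ≤ δ := by
    intro w hw
    have hw1 := (hagree s hs).level_candidate hC hw
    rcases (hmonoT s(u, w)).eq_or_lt with heq | hwlt
    · rw [hw1, heq]
      linarith
    · have h1 := hlow w hw ((hmono _ h0T hs hs.1).trans_lt hwlt) v hv
      have h2 := hmin w hw
      linarith
  have hu : level G (y T) u - level G (y s) u ≤ n * δ := by
    rw [(hagree s hs).level_active hC]
    refine (Finset.sum_le_card_nsmul _ _ δ fun w hw => hcand w (Finset.mem_filter.1 hw).2).trans_eq ?_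
    rw [nsmul_eq_mul]
  refine ⟨(level G (y s) u, level G (y s) v), hall, ?_⟩
  have hu0 := level_mono (G := G) hmonoT u
  have hv0 := level_mono (G := G) hmonoT v
  have hv2 := hcand v hv
  rw [Prod.dist_eq, Real.dist_eq, Real.dist_eq, abs_of_nonneg (by linarith),
    abs_of_nonneg (by linarith)]
  refine max_lt ?_ ?_ <;> nlinarith

theorem MatchedTo.lt_iff (h : MatchedTo G u C allowed x x') (hC : ∀ v ∈ C, G.Adj u v) {v : V}
    (hv : v ∈ C) : level G x v < level G x' v ↔ x s(u, v) < x' s(u, v) := by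
  have := h.agreeOff.level_candidate hC hv
  constructor <;> intro _ <;> linarith

theorem MatchedTo.mono {allowed' : ℝ → ℝ → Prop} (h : MatchedTo G u C allowed x x')
    (ha : ∀ a b, allowed a b → allowed' a b) : MatchedTo G u C allowed' x x' :=
  ⟨h.agreeOff, h.le, h.lowest, fun v hv hlt =>
    closure_mono (fun p hp => ha p.1 p.2 hp) (h.mem_closure v hv hlt)⟩

/-- Once the allowed pairs are closed, they contain the final levels of a matched pair. -/
theorem MatchedTo.allowed_of_isClosed (h : MatchedTo G u C allowed x x')
    (hcl : IsClosed {p : ℝ × ℝ | allowed p.1 p.2}) {v : V} (hv : v ∈ C)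
    (hlt : x s(u, v) < x' s(u, v)) : allowed (level G x' u) (level G x' v) := by
  have := h.mem_closure v hv hlt
  rwa [hcl.closure_eq] at this

/-- If `x₂` exceeds `x₁` on an edge `uv`, the lowest-level rule makes every candidate at least as
high in `x₂`, so `u` is strictly higher too. The pair allowed in `x₂` then contradicts halting in
`x₁`. -/
theorem MatchedTo.le_of_halt {halt : ℝ → ℝ → Prop} (hC : ∀ v ∈ C, G.Adj u v)
    (hcl : IsClosed {p : ℝ × ℝ | allowed p.1 p.2})
    (hend : ∀ a b a' b', allowed a' b' → a < a' → b < b' → ¬ halt a b)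
    (h₁ : MatchedTo G u C allowed x x₁) (h₂ : MatchedTo G u C allowed x x₂)
    (hs : ∀ v ∈ C, halt (level G x₁ u) (level G x₁ v)) (e : Sym2 V) : x₂ e ≤ x₁ e := by
  classical
  by_contra hlt
  rw [not_le] at hlt
  have hex : ∃ v ∈ C, e = s(u, v) := by
    by_contra hno
    push Not at hno
    rw [h₁.agreeOff e hno, h₂.agreeOff e hno] at hlt
    exact lt_irrefl _ hlt
  obtain ⟨v, hv, rfl⟩ := hex
  have hv2 : x s(u, v) < x₂ s(u, v) := (h₁.le _).trans_lt hlt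
  have c₁ := fun w (hw : w ∈ C) => h₁.agreeOff.level_candidate hC hw
  have c₂ := fun w (hw : w ∈ C) => h₂.agreeOff.level_candidate hC hw
  have hvl : level G x₁ v < level G x₂ v := by linarith [c₁ v hv, c₂ v hv]
  have hall : ∀ w ∈ C, level G x₁ w ≤ level G x₂ w := by
    intro w hw
    by_contra hwlt
    rw [not_le] at hwlt
    have hw1 : x s(u, w) < x₁ s(u, w) := by linarith [c₁ w hw, c₂ w hw, h₂.le s(u, w)]
    linarith [h₁.lowest w hw hw1 v hv, h₂.lowest v hv hv2 w hw]
  have hul : level G x₁ u < level G x₂ u := by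
    have h1 := h₁.agreeOff.level_active hC
    have h2 := h₂.agreeOff.level_active hC
    have h3 : ∑ w with w ∈ C, (level G x₁ w - level G x w) <
        ∑ w with w ∈ C, (level G x₂ w - level G x w) :=
      Finset.sum_lt_sum
        (fun w hw => sub_le_sub_right (hall w (Finset.mem_filter.1 hw).2) _)
        ⟨v, Finset.mem_filter.2 ⟨Finset.mem_univ _, hv⟩, sub_lt_sub_right hvl _⟩
    linarith
  exact hend _ _ _ _ (h₂.allowed_of_isClosed hcl hv hv2) hul hvl (hs v hv)

end MatchingProcess

/-! ### Existence of outcomes by explicit water-filling -/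

section Filling

variable {V : Type u} [Fintype V] {G : SimpleGraph V} {x : Sym2 V → ℝ}
  {u : V} {C : Set V} {allowed : ℝ → ℝ → Prop}

open Classical in
/-- Match `u` to the vertices of `C` until all of them have level at least `s`. -/
noncomputable def fill (G : SimpleGraph V) (u : V) (C : Set V) (x : Sym2 V → ℝ) (s : ℝ) :
    Sym2 V → ℝ :=
  fun e => x e + ∑ v with v ∈ C, if e = s(u, v) then max 0 (s - level G x v) else 0

theorem fill_candidate {v : V} (hv : v ∈ C) (s : ℝ) :
    fill G u C x s s(u, v) = x s(u, v) + max 0 (s - level G x v) := by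
  classical
  rw [fill, Finset.sum_eq_single v]
  · simp
  · intro w _ hw
    rw [if_neg]
    rw [Sym2.congr_right]
    exact hw.symm
  · intro h
    exact absurd (Finset.mem_filter.2 ⟨Finset.mem_univ _, hv⟩) h

theorem agreeOff_fill (s : ℝ) : AgreeOff u C x (fill G u C x s) := by
  classical
  intro e he
  rw [fill, Finset.sum_eq_zero, add_zero]
  intro v hv
  rw [if_neg (he v (Finset.mem_filter.1 hv).2)]

theorem level_fill_candidate (hC : ∀ v ∈ C, G.Adj u v) {v : V} (hv : v ∈ C) (s : ℝ) :
    level G (fill G u C x s) v = max (level G x v) s := by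
  have h := (agreeOff_fill (G := G) (u := u) (x := x) (C := C) s).level_candidate hC hv
  rw [fill_candidate hv] at h
  rcases le_total (level G x v) s with hs | hs
  · rw [max_eq_right hs]
    rw [max_eq_right (by linarith)] at h
    linarith
  · rw [max_eq_left hs]
    rw [max_eq_left (by linarith)] at h
    linarith

open Classical in
theorem level_fill_active (hC : ∀ v ∈ C, G.Adj u v) (s : ℝ) :
    level G (fill G u C x s) u = level G x u + ∑ v with v ∈ C, (max (level G x v) s - level G x v) := by
  have h := (agreeOff_fill (G := G) (u := u) (x := x) (C := C) s).level_active hC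
  rw [Finset.sum_congr rfl fun v hv =>
    by rw [level_fill_candidate hC (Finset.mem_filter.1 hv).2]] at h
  linarith

theorem fill_mono {s t : ℝ} (h : s ≤ t) (e : Sym2 V) : fill G u C x s e ≤ fill G u C x t e := by
  classical
  refine add_le_add le_rfl (Finset.sum_le_sum fun v _ => ?_)
  split_ifs
  · exact max_le_max le_rfl (by linarith)
  · exact le_rfl

theorem continuous_fill (e : Sym2 V) : Continuous fun s => fill G u C x s e := by
  classical
  refine continuous_const.add (continuous_finsetSum _ fun v _ => ?_)
  split_ifs
  · fun_prop
  · exact continuous_const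

theorem continuous_level_fill (v : V) : Continuous fun s => level G (fill G u C x s) v :=
  continuous_finsetSum _ fun _ _ => continuous_fill _

theorem fill_of_le (h : ∀ v ∈ C, 0 ≤ level G x v) : fill G u C x 0 = x := by
  classical
  funext e
  rw [fill, Finset.sum_eq_zero, add_zero]
  intro v hv
  have := h v (Finset.mem_filter.1 hv).2
  split_ifs
  · exact max_eq_left (by linarith)
  · rfl

theorem level_fill_active_mono {s t : ℝ} (h : s ≤ t) :
    level G (fill G u C x s) u ≤ level G (fill G u C x t) u :=
  level_mono (fill_mono h) u

theorem level_fill_active_strict (hC : ∀ v ∈ C, G.Adj u v) {s t : ℝ} (h : s < t) {v : V}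
    (hv : v ∈ C) (hvs : level G x v ≤ s) :
    level G (fill G u C x s) u < level G (fill G u C x t) u := by
  classical
  rw [level_fill_active hC, level_fill_active hC]
  refine add_lt_add_right (Finset.sum_lt_sum
    (fun w _ => sub_le_sub_right (max_le_max le_rfl h.le) _)
    ⟨v, Finset.mem_filter.2 ⟨Finset.mem_univ _, hv⟩, sub_lt_sub_right ?_ _⟩) _
  rw [max_eq_right hvs]
  exact lt_max_of_lt_right h

/-- The common water level serves as time: a candidate rises just after `s` only if its initial
level is at most `s`, and then its current level is `s`, the minimum. -/
theorem continuouslyMatches_fill (hC : ∀ v ∈ C, G.Adj u v) (hl : ∀ v ∈ C, 0 ≤ level G x v) {T : ℝ}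
    (hT : 0 ≤ T) (hall : ∀ s ∈ Set.Ico 0 T, ∀ v ∈ C, level G x v ≤ s →
      allowed (level G (fill G u C x s) u) s) :
    ContinuouslyMatches G u C allowed x (fill G u C x T) := by
  refine ⟨T, fill G u C x, hT, fill_of_le hl, rfl, fun e => (continuous_fill e).continuousOn,
    fun e s _ t _ h => fill_mono h e, fun s hs e he => ?_⟩
  have hTlt := he T ⟨hs.2, le_rfl⟩
  have hex : ∃ v ∈ C, e = s(u, v) := by
    by_contra hno
    push Not at hno
    rw [agreeOff_fill s e hno, agreeOff_fill T e hno] at hTlt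
    exact lt_irrefl _ hTlt
  obtain ⟨v, hv, rfl⟩ := hex
  have hvs : level G x v ≤ s := by
    by_contra hlt
    rw [not_le] at hlt
    rcases le_or_gt (level G x v) T with h | h
    · have h1 := he (level G x v) ⟨hlt, h⟩
      rw [fill_candidate hv, fill_candidate hv, sub_self, max_self] at h1
      linarith [le_max_left 0 (s - level G x v)]
    · rw [fill_candidate hv, fill_candidate hv, max_eq_left (b := T - level G x v) (by linarith)] at hTlt
      linarith [le_max_left 0 (s - level G x v)]
  have hlv : level G (fill G u C x s) v = s := by
    rw [level_fill_candidate hC hv, max_eq_right hvs]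
  refine ⟨v, hv, rfl, fun w hw => ?_, ?_⟩
  · rw [hlv, level_fill_candidate hC hw]
    exact le_max_right _ _
  · rw [hlv]
    exact hall s hs v hv hvs

variable {f : ℝ → ℝ}

theorem exists_arrival_outcome (hf : StrictMono f) (hfc : Continuous f) (f0 : f 0 = 0)
    (f1 : f 1 = 1) (hC : ∀ v ∈ C, G.Adj u v) (hx : ∀ e, 0 ≤ x e) (hu : level G x u ≤ 1) :
    ∃ x', ContinuouslyMatches G u C (fun a b => a < 1 ∧ b < 1 ∧ f a + f b ≤ 1) x x' ∧
      ∀ v ∈ C, 1 ≤ f (level G x' u) + f (level G x' v) := by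
  have hl := fun v (_ : v ∈ C) => level_nonneg (G := G) hx v
  set g : ℝ → ℝ := fun s => f (level G (fill G u C x s) u) + f s
  have hg : Continuous g := (hfc.comp (continuous_level_fill u)).add hfc
  have hg0 : g 0 ≤ 1 := by
    simp only [g, fill_of_le hl, f0, add_zero]
    exact f1 ▸ hf.monotone hu
  have hg1 : 1 ≤ g 1 := by
    simp only [g, f1]
    have h1 : 0 ≤ level G (fill G u C x 1) u :=
      (level_nonneg hx u).trans (by
        conv_lhs => rw [← fill_of_le (u := u) hl]
        exact level_fill_active_mono zero_le_one)
    have := hf.monotone h1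
    linarith
  -- Stop at the water level where the two prices sum to exactly 1.
  obtain ⟨T, hT, hgT⟩ := intermediate_value_Icc zero_le_one hg.continuousOn ⟨hg0, hg1⟩
  refine ⟨fill G u C x T, continuouslyMatches_fill hC hl hT.1 fun s hs v hv hvs => ?_,
    fun v hv => ?_⟩
  · have h1 := hf (level_fill_active_strict hC hs.2 hv hvs)
    have h2 := hf hs.2
    have h3 := hf.monotone hT.1
    have h4 := hf.monotone hs.1
    simp only [g] at hgT
    refine ⟨?_, by linarith [hs.2, hT.2], by linarith⟩
    rw [← hf.lt_iff_lt]
    linarith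
  · rw [level_fill_candidate hC hv]
    have := hf.monotone (le_max_right (level G x v) T)
    simp only [g] at hgT
    linarith

theorem exists_deadline_outcome (hC : ∀ v ∈ C, G.Adj u v) (hx : ∀ e, 0 ≤ x e)
    (hl1 : ∀ v, level G x v ≤ 1) :
    ∃ x', ContinuouslyMatches G u C (fun a b => a < 1 ∧ b < 1) x x' ∧
      (level G x' u = 1 ∨ ∀ v ∈ C, level G x' v = 1) := by
  have hl := fun v (_ : v ∈ C) => level_nonneg (G := G) hx v
  rcases le_total (level G (fill G u C x 1) u) 1 with h | h
  · refine ⟨fill G u C x 1, continuouslyMatches_fill hC hl zero_le_one fun s hs v hv hvs =>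
      ⟨(level_fill_active_strict hC hs.2 hv hvs).trans_le h, hs.2⟩, Or.inr fun v hv => ?_⟩
    rw [level_fill_candidate hC hv, max_eq_right (hl1 v)]
  · obtain ⟨T, hT, hgT⟩ := intermediate_value_Icc zero_le_one
      (continuous_level_fill (G := G) (C := C) (x := x) u).continuousOn
      ⟨by rw [fill_of_le hl]; exact hl1 u, h⟩
    exact ⟨fill G u C x T, continuouslyMatches_fill hC hl hT.1 fun s hs v hv hvs =>
      ⟨(level_fill_active_strict hC hs.2 hv hvs).trans_le hgT.le, hs.2.trans_le hT.2⟩, Or.inl hgT⟩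

end Filling

/-! ### Conditions on the gain-sharing function -/

/-- The properties of `f`, its primitive `F` and the ratio `Γ` that the primal-dual analysis of
Eager Water-filling uses. -/
structure GainSharing (f F : ℝ → ℝ) (Γ : ℝ) : Prop where
  strictMono : StrictMono f
  continuous : Continuous f
  f_zero : f 0 = 0
  f_one : f 1 = 1
  F_zero : F 0 = 0
  -- The subgradient inequality replaces `F' = f`, so no integral is needed.
  mul_le_sub : ∀ a b, (b - a) * f a ≤ F b - F a
  le_full : Γ ≤ F 1
  le_earlier : ∀ b ∈ Set.Icc (0 : ℝ) 1, Γ ≤ 1 - f b + F b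
  le_later : ∀ p ∈ Set.Icc (0 : ℝ) 1, ∀ b ∈ Set.Icc (0 : ℝ) 1, ∀ a ∈ Set.Icc (0 : ℝ) b,
    1 ≤ f a + f p → Γ ≤ (a * f a - F a) + F p + (1 - p) * (1 - f b) + F b

namespace GainSharing

variable {f F : ℝ → ℝ} {Γ : ℝ}

theorem sub_le_mul (h : GainSharing f F Γ) (a b : ℝ) : F b - F a ≤ (b - a) * f b := by
  have := h.mul_le_sub b a
  linarith

theorem f_nonneg (h : GainSharing f F Γ) {a : ℝ} (ha : 0 ≤ a) : 0 ≤ f a :=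
  h.f_zero ▸ h.strictMono.monotone ha

theorem f_le_one (h : GainSharing f F Γ) {a : ℝ} (ha : a ≤ 1) : f a ≤ 1 :=
  h.f_one ▸ h.strictMono.monotone ha

theorem F_mono (h : GainSharing f F Γ) {a b : ℝ} (ha : 0 ≤ a) (hab : a ≤ b) : F a ≤ F b := by
  have := h.mul_le_sub a b
  nlinarith [h.f_nonneg ha]

theorem F_le_mul (h : GainSharing f F Γ) (a : ℝ) : F a ≤ a * f a := by
  have := h.sub_le_mul 0 a
  rw [h.F_zero] at this
  linarith

/-- The dual constraint of an edge after the deadline of an endpoint that is full, if the other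
endpoint arrived earlier. -/
theorem le_of_earlier (h : GainSharing f F Γ) {a p b : ℝ} (hap : a ≤ p) (ha : 0 ≤ a)
    (hb : b ∈ Set.Icc (0 : ℝ) 1) (hab : 1 ≤ f a + f b) :
    Γ ≤ (a * f a + F p - F a) + (1 - p) * (1 - f b) + F b := by
  have h1 := h.le_earlier b hb
  have h2 := h.mul_le_sub a p
  -- By `h2` the first bracket is at least `p * f a`, hence at least `p * (1 - f b)`; the sum is
  -- then at least `1 - f b + F b`.
  nlinarith

end GainSharing

/-! ### Sharing the gain of one step -/

section Dual

variable {V : Type u} [Fintype V] {G : SimpleGraph V} {x x' : Sym2 V → ℝ}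
  {u : V} {C : Set V} {f F : ℝ → ℝ} {Γ : ℝ} {allowed : ℝ → ℝ → Prop}

open Classical in
/-- The part of the newly matched amount that goes to the active vertex. -/
noncomputable def activeGain (G : SimpleGraph V) (C : Set V) (F : ℝ → ℝ) (x x' : Sym2 V → ℝ) : ℝ :=
  ∑ v with v ∈ C, ((level G x' v - level G x v) - (F (level G x' v) - F (level G x v)))

open Classical in
/-- The dual variables after a step of `u` : the newly matched amount is shared between `u` and
its candidates. -/
noncomputable def dualUpdate (G : SimpleGraph V) (u : V) (C : Set V) (F : ℝ → ℝ)
    (x x' : Sym2 V → ℝ) (α : V → ℝ) (v : V) : ℝ :=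
  if v = u then α u + activeGain G C F x x'
  else α v + (F (level G x' v) - F (level G x v))

theorem sum_dualUpdate (h : AgreeOff u C x x') (hC : ∀ v ∈ C, G.Adj u v) (α : V → ℝ) :
    ∑ v, dualUpdate G u C F x x' α v = ∑ v, α v + (size G x' - size G x) := by
  classical
  have hu : u ∉ Finset.univ.filter (· ∈ C) := fun hu => (hC u (Finset.mem_filter.1 hu).2).ne rfl
  have key : ∑ v, (dualUpdate G u C F x x' α v - α v) =
      ∑ v ∈ insert u (Finset.univ.filter (· ∈ C)), (dualUpdate G u C F x x' α v - α v) := by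
    symm
    refine Finset.sum_subset (Finset.subset_univ _) fun v _ hv => ?_
    rw [Finset.mem_insert, not_or, Finset.mem_filter] at hv
    rw [dualUpdate, if_neg hv.1, h.level_other (fun hC => hv.2 ⟨Finset.mem_univ _, hC⟩) hv.1]
    ring
  have hcand : ∑ v with v ∈ C, (dualUpdate G u C F x x' α v - α v) =
      ∑ v with v ∈ C, (F (level G x' v) - F (level G x v)) := by
    refine Finset.sum_congr rfl fun v hv => ?_
    rw [dualUpdate, if_neg (hC v (Finset.mem_filter.1 hv).2).ne']
    ring
  rw [Finset.sum_insert hu, hcand, dualUpdate, if_pos rfl, activeGain, Finset.sum_sub_distrib,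
    Finset.sum_sub_distrib, ← h.size_eq hC] at key
  linarith

/-- Since `f` increases, a candidate never takes more per unit than the price at its final level. -/
theorem activeGain_ge (hG : GainSharing f F Γ) (h : MatchedTo G u C allowed x x')
    (hC : ∀ v ∈ C, G.Adj u v) {c : ℝ}
    (hc : ∀ v ∈ C, level G x v < level G x' v → f (level G x' v) ≤ c) :
    (level G x' u - level G x u) * (1 - c) ≤ activeGain G C F x x' := by
  classical
  rw [h.agreeOff.level_active hC, Finset.sum_mul]
  refine Finset.sum_le_sum fun v hv => ?_
  have hv := (Finset.mem_filter.1 hv).2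
  rcases (level_mono (G := G) h.le v).eq_or_lt with heq | hlt
  · rw [heq]
    simp
  · have := hG.sub_le_mul (level G x v) (level G x' v)
    nlinarith [hc v hv hlt]

theorem le_dualUpdate (hG : GainSharing f F Γ) (h : MatchedTo G u C allowed x x')
    (hC : ∀ v ∈ C, G.Adj u v) (hx : ∀ e, 0 ≤ x e) (hl : ∀ v, level G x' v ≤ 1) (α : V → ℝ) (v : V) :
    α v ≤ dualUpdate G u C F x x' α v := by
  rw [dualUpdate]
  split_ifs with hv
  · subst hv
    have := activeGain_ge hG h hC (c := 1) fun w _ _ => hG.f_le_one (hl w)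
    linarith
  · have := hG.F_mono (level_nonneg hx v) (level_mono (G := G) h.le v)
    linarith

theorem MatchedTo.level_le_one (h : MatchedTo G u C (fun a b => a ≤ 1 ∧ b ≤ 1) x x')
    (hC : ∀ v ∈ C, G.Adj u v) (hl : ∀ v, level G x v ≤ 1) (v : V) : level G x' v ≤ 1 := by
  classical
  have hcl : IsClosed {p : ℝ × ℝ | p.1 ≤ 1 ∧ p.2 ≤ 1} :=
    (isClosed_le continuous_fst continuous_const).inter
      (isClosed_le continuous_snd continuous_const)
  by_cases hv : v ∈ C
  · rcases (level_mono (G := G) h.le v).eq_or_lt with heq | hlt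
    · exact heq ▸ hl v
    · exact (h.allowed_of_isClosed hcl hv ((h.lt_iff hC hv).1 hlt)).2
  by_cases hu : v = u
  · subst hu
    by_cases hex : ∃ w ∈ C, level G x w < level G x' w
    · obtain ⟨w, hw, hlt⟩ := hex
      exact (h.allowed_of_isClosed hcl hw ((h.lt_iff hC hw).1 hlt)).1
    · push Not at hex
      have h1 := h.agreeOff.level_active hC
      rw [Finset.sum_eq_zero fun w hw => ?_] at h1
      · linarith [hl v]
      · have hw := (Finset.mem_filter.1 hw).2
        linarith [hex w hw, level_mono (G := G) h.le w]
  · exact (h.agreeOff.level_other hv hu).symm ▸ hl v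

end Dual

/-! ### The dual invariant along the events -/

section Analysis

variable {V : Type u} [Fintype V] {I : Instance V} {f F : ℝ → ℝ} {Γ : ℝ}
  {i : Fin (2 * Fintype.card V)} {u : V} {x x' x₁ x₂ : Sym2 V → ℝ} {α a : V → ℝ}

namespace Instance

/-- The position of the arrival of `v`. -/
def arrivalTime (I : Instance V) (v : V) : ℕ := (I.event.symm (.arrival v)).val

/-- The position of the deadline of `v`. -/
def deadlineTime (I : Instance V) (v : V) : ℕ := (I.event.symm (.deadline v)).val

theorem arrivalTime_lt_deadlineTime (v : V) : I.arrivalTime v < I.deadlineTime v :=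
  I.arrival_lt_deadline v

theorem arrivalTime_injective {v w : V} (h : I.arrivalTime v = I.arrivalTime w) : v = w := by
  have := I.event.symm.injective (Fin.ext h)
  injection this

theorem deadlineTime_injective {v w : V} (h : I.deadlineTime v = I.deadlineTime w) : v = w := by
  have := I.event.symm.injective (Fin.ext h)
  injection this

theorem arrivalTime_ne_deadlineTime (v w : V) : I.arrivalTime v ≠ I.deadlineTime w := by
  intro h
  have := I.event.symm.injective (Fin.ext h)
  injection this

theorem arrivalTime_eq (h : I.event i = .arrival u) : I.arrivalTime u = i.val := by
  rw [arrivalTime, ← h, Equiv.symm_apply_apply]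

theorem deadlineTime_eq (h : I.event i = .deadline u) : I.deadlineTime u = i.val := by
  rw [deadlineTime, ← h, Equiv.symm_apply_apply]

theorem adj_of_mem_available : ∀ v ∈ I.available i u, I.graph.Adj u v := fun _ hv => hv.1

theorem mem_available_iff {v : V} : v ∈ I.available i u ↔
    I.graph.Adj u v ∧ I.arrivalTime v < i.val ∧ i.val < I.deadlineTime v := Iff.rfl

theorem eagerStep_arrival_iff (h : I.event i = .arrival u) :
    I.EagerStep f i x x' ↔ I.ArrivalStep f i u x x' := by
  rw [EagerStep, h]

theorem eagerStep_deadline_iff (h : I.event i = .deadline u) :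
    I.EagerStep f i x x' ↔ I.DeadlineStep i u x x' := by
  rw [EagerStep, h]

/-- Weakening the strict inequalities makes the allowed set closed, so that final levels satisfy it.
-/
theorem ArrivalStep.matchedTo (h : I.ArrivalStep f i u x x') :
    MatchedTo I.graph u (I.available i u) (fun a b => a ≤ 1 ∧ b ≤ 1 ∧ f a + f b ≤ 1) x x' :=
  (h.1.matchedTo adj_of_mem_available).mono fun _ _ h => ⟨h.1.le, h.2.1.le, h.2.2⟩

theorem DeadlineStep.matchedTo (h : I.DeadlineStep i u x x') :
    MatchedTo I.graph u (I.available i u) (fun a b => a ≤ 1 ∧ b ≤ 1) x x' :=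
  (h.1.matchedTo adj_of_mem_available).mono fun _ _ h => ⟨h.1.le, h.2.le⟩

theorem isClosed_arrival_allowed (hf : Continuous f) :
    IsClosed {p : ℝ × ℝ | p.1 ≤ 1 ∧ p.2 ≤ 1 ∧ f p.1 + f p.2 ≤ 1} :=
  (isClosed_le continuous_fst continuous_const).inter
    ((isClosed_le continuous_snd continuous_const).inter
      (isClosed_le ((hf.comp continuous_fst).add (hf.comp continuous_snd)) continuous_const))

theorem isClosed_deadline_allowed : IsClosed {p : ℝ × ℝ | p.1 ≤ 1 ∧ p.2 ≤ 1} :=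
  (isClosed_le continuous_fst continuous_const).inter (isClosed_le continuous_snd continuous_const)

theorem EagerStep.unique (hf : StrictMono f) (hfc : Continuous f) (h₁ : I.EagerStep f i x x₁)
    (h₂ : I.EagerStep f i x x₂) : x₁ = x₂ := by
  rcases hi : I.event i with u | u
  · rw [eagerStep_arrival_iff hi] at h₁ h₂
    have key : ∀ y₁ y₂, I.ArrivalStep f i u x y₁ → I.ArrivalStep f i u x y₂ → ∀ e, y₂ e ≤ y₁ e :=
      fun y₁ y₂ k₁ k₂ e => MatchedTo.le_of_halt (halt := fun a b => 1 ≤ f a + f b)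
        adj_of_mem_available (isClosed_arrival_allowed hfc)
        (fun a b a' b' hall ha hb hs => by linarith [hf ha, hf hb, hall.2.2])
        k₁.matchedTo k₂.matchedTo k₁.2 e
    exact funext fun e => le_antisymm (key _ _ h₂ h₁ e) (key _ _ h₁ h₂ e)
  · rw [eagerStep_deadline_iff hi] at h₁ h₂
    have key : ∀ y₁ y₂, I.DeadlineStep i u x y₁ → I.DeadlineStep i u x y₂ → ∀ e, y₂ e ≤ y₁ e :=
      fun y₁ y₂ k₁ k₂ e => MatchedTo.le_of_halt (halt := fun a b => a = 1 ∨ b = 1)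
        adj_of_mem_available isClosed_deadline_allowed
        (fun a b a' b' hall ha hb hs => by rcases hs with h | h <;> linarith [hall.1, hall.2])
        k₁.matchedTo k₂.matchedTo (fun v hv => k₁.2.imp id fun h => h v hv) e
    exact funext fun e => le_antisymm (key _ _ h₂ h₁ e) (key _ _ h₁ h₂ e)

theorem exists_eagerStep (hf : StrictMono f) (hfc : Continuous f) (f0 : f 0 = 0) (f1 : f 1 = 1)
    (hx : ∀ e, 0 ≤ x e) (hl : ∀ v, level I.graph x v ≤ 1) : ∃ x', I.EagerStep f i x x' := by
  rcases hi : I.event i with u | u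
  · obtain ⟨x', h⟩ := exists_arrival_outcome hf hfc f0 f1 (adj_of_mem_available (i := i)) hx (hl u)
    exact ⟨x', (eagerStep_arrival_iff hi).2 h⟩
  · obtain ⟨x', h⟩ := exists_deadline_outcome (u := u) (adj_of_mem_available (i := i)) hx hl
    exact ⟨x', (eagerStep_deadline_iff hi).2 h⟩

theorem EagerStep.feasible (h : I.EagerStep f i x x') (hx : ∀ e, 0 ≤ x e)
    (hl : ∀ v, level I.graph x v ≤ 1) : (∀ e, 0 ≤ x' e) ∧ ∀ v, level I.graph x' v ≤ 1 := by
  rcases hi : I.event i with u | u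
  · have hm := ((eagerStep_arrival_iff hi).1 h).matchedTo
    exact ⟨fun e => (hx e).trans (hm.le e),
      (hm.mono fun _ _ h => ⟨h.1, h.2.1⟩).level_le_one adj_of_mem_available hl⟩
  · have hm := ((eagerStep_deadline_iff hi).1 h).matchedTo
    exact ⟨fun e => (hx e).trans (hm.le e), hm.level_le_one adj_of_mem_available hl⟩

/-- The state before the event at position `k`. Here `α` is the dual solution and `a v` the level
of `v` right after its arrival. -/
structure DualInvariant (I : Instance V) (f F : ℝ → ℝ) (Γ : ℝ) (k : ℕ) (x : Sym2 V → ℝ)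
    (α a : V → ℝ) : Prop where
  nonneg : ∀ e, 0 ≤ x e
  level_le : ∀ v, level I.graph x v ≤ 1
  unarrived : ∀ v, k ≤ I.arrivalTime v → level I.graph x v = 0
  sum_dual : ∑ v, α v = size I.graph x
  dual_nonneg : ∀ v, 0 ≤ α v
  base_nonneg : ∀ v, 0 ≤ a v
  base_le : ∀ v, a v ≤ level I.graph x v
  gain : ∀ v, k ≤ I.deadlineTime v → a v * f (a v) + F (level I.graph x v) - F (a v) ≤ α v
  active : ∀ v w, I.graph.Adj v w → I.arrivalTime w < I.arrivalTime v → I.arrivalTime v < k →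
    k ≤ I.deadlineTime v → k ≤ I.deadlineTime w → 1 ≤ f (a v) + f (level I.graph x w)
  cover : ∀ v w, I.graph.Adj v w → I.deadlineTime v < k → Γ ≤ α v + α w

theorem dualInvariant_zero : I.DualInvariant f F Γ 0 0 0 0 := by
  have h0 : ∀ v, level I.graph 0 v = 0 := fun v => by simp [level]
  constructor <;> simp [h0, size]

theorem DualInvariant.arrival (hG : GainSharing f F Γ) (hI : I.DualInvariant f F Γ i.val x α a)
    (hi : I.event i = .arrival u) (h : I.ArrivalStep f i u x x') :
    ∃ α' a', I.DualInvariant f F Γ (i.val + 1) x' α' a' := by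
  classical
  have hm := h.matchedTo
  have hC := adj_of_mem_available (I := I) (i := i) (u := u)
  have hfeas := ((eagerStep_arrival_iff hi).2 h).feasible hI.nonneg hI.level_le
  have hmono := level_mono (G := I.graph) hm.le
  have hu := arrivalTime_eq hi
  have hu0 : level I.graph x u = 0 := hI.unarrived u hu.ge
  have hα := le_dualUpdate hG hm hC hI.nonneg hfeas.2 α
  refine ⟨dualUpdate I.graph u (I.available i u) F x x' α,
    Function.update a u (level I.graph x' u), hfeas.1, hfeas.2, ?_, ?_,
    fun v => (hI.dual_nonneg v).trans (hα v), ?_, ?_, ?_, ?_, ?_⟩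
  · intro v hv
    rw [hm.agreeOff.level_other (fun hvC => ?_) (fun hvu => ?_), hI.unarrived v (by omega)]
    · have := (mem_available_iff.1 hvC).2.1
      omega
    · subst hvu
      omega
  · rw [sum_dualUpdate hm.agreeOff hC, hI.sum_dual]
    ring
  · intro v
    rcases eq_or_ne v u with rfl | hv
    · rw [Function.update_self]
      exact level_nonneg hfeas.1 _
    · rw [Function.update_of_ne hv]
      exact hI.base_nonneg v
  · intro v
    rcases eq_or_ne v u with rfl | hv
    · rw [Function.update_self]
    · rw [Function.update_of_ne hv]
      exact (hI.base_le v).trans (hmono v)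
  · intro v hv
    rcases eq_or_ne v u with rfl | hvu
    · rw [Function.update_self, dualUpdate, if_pos rfl]
      -- Raised candidates end with price at most `1 - f (x_v)`, so the new vertex earns at least `f
      -- (x_v)` per unit from level 0.
      have h1 := activeGain_ge hG hm hC (c := 1 - f (level I.graph x' v)) fun w hw hlt => by
        have := (hm.allowed_of_isClosed (isClosed_arrival_allowed hG.continuous) hw
          ((hm.lt_iff hC hw).1 hlt)).2.2
        linarith
      have h2 := hI.dual_nonneg v
      rw [hu0] at h1
      linarith
    · rw [Function.update_of_ne hvu, dualUpdate, if_neg hvu]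
      linarith [hI.gain v (by omega)]
  · intro v w hvw hlt hv hdv hdw
    rcases eq_or_ne v u with rfl | hvu
    · rw [Function.update_self]
      exact h.2 w (mem_available_iff.2 ⟨hvw, by omega, by omega⟩)
    · have hne : I.arrivalTime v ≠ i.val := fun he =>
        hvu (arrivalTime_injective (I := I) (he.trans hu.symm))
      rw [Function.update_of_ne hvu]
      have h1 := hI.active v w hvw hlt (by omega) (by omega) (by omega)
      linarith [hG.strictMono.monotone (hmono w)]
  · intro v w hvw hv
    have hne := I.arrivalTime_ne_deadlineTime u v
    linarith [hI.cover v w hvw (by omega), hα v, hα w]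

theorem DualInvariant.deadline (hG : GainSharing f F Γ) (hI : I.DualInvariant f F Γ i.val x α a)
    (hi : I.event i = .deadline u) (h : I.DeadlineStep i u x x') :
    ∃ α' a', I.DualInvariant f F Γ (i.val + 1) x' α' a' := by
  classical
  have hm := h.matchedTo
  have hC := adj_of_mem_available (I := I) (i := i) (u := u)
  have hfeas := ((eagerStep_deadline_iff (f := f) hi).2 h).feasible hI.nonneg hI.level_le
  have hmono := level_mono (G := I.graph) hm.le
  have hu := deadlineTime_eq hi
  have hau := I.arrivalTime_lt_deadlineTime u
  have hα := le_dualUpdate hG hm hC hI.nonneg hfeas.2 α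
  have hgain : ∀ v, v ≠ u → i.val ≤ I.deadlineTime v →
      a v * f (a v) + F (level I.graph x' v) - F (a v) ≤
        dualUpdate I.graph u (I.available i u) F x x' α v := by
    intro v hvu hv
    rw [dualUpdate, if_neg hvu]
    linarith [hI.gain v hv]
  refine ⟨dualUpdate I.graph u (I.available i u) F x x' α, a, hfeas.1, hfeas.2, ?_, ?_,
    fun v => (hI.dual_nonneg v).trans (hα v), hI.base_nonneg,
    fun v => (hI.base_le v).trans (hmono v), ?_, ?_, ?_⟩
  · intro v hv
    rw [hm.agreeOff.level_other (fun hvC => ?_) (fun hvu => ?_), hI.unarrived v (by omega)]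
    · have := (mem_available_iff.1 hvC).2.1
      omega
    · subst hvu
      omega
  · rw [sum_dualUpdate hm.agreeOff hC, hI.sum_dual]
    ring
  · intro v hv
    refine hgain v (fun hvu => ?_) (by omega)
    subst hvu
    omega
  · intro v w hvw hlt hv hdv hdw
    have h1 := hI.active v w hvw hlt (by
      have : I.arrivalTime v ≠ i.val := hu ▸ I.arrivalTime_ne_deadlineTime v u
      omega) (by omega) (by omega)
    linarith [hG.strictMono.monotone (hmono w)]
  · intro v w hvw hv
    rcases eq_or_ne v u with rfl | hvu
    swap
    · have hne : I.deadlineTime v ≠ i.val := fun he =>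
        hvu (deadlineTime_injective (I := I) (he.trans hu.symm))
      linarith [hI.cover v w hvw (by omega), hα v, hα w]
    rcases lt_or_ge (I.deadlineTime w) i.val with hw | hw
    -- The edge was covered at the earlier deadline, and dual values never decrease.
    · linarith [hI.cover w v hvw.symm hw, hα v, hα w]
    have hne : I.deadlineTime w ≠ i.val := fun he =>
      hvw.ne (deadlineTime_injective (I := I) (hu.trans he.symm))
    have haw : I.arrivalTime w < I.deadlineTime v := I.neighbor_arrival_lt_deadline v w hvw
    have hwC : w ∈ I.available i v := mem_available_iff.2 ⟨hvw, by omega, by omega⟩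
    have hgw := hgain w hvw.ne' hw
    have hgv := hI.gain v hu.ge
    have haF := hG.F_le_mul (a w)
    have haFv := hG.F_le_mul (a v)
    have hv0 := (hI.dual_nonneg v).trans (hα v)
    have hb : level I.graph x' w ∈ Set.Icc (0 : ℝ) 1 := ⟨level_nonneg hfeas.1 w, hfeas.2 w⟩
    rcases h.2 with hfull | hfull
    -- Every raised candidate ends lowest, so its price is at most that of `w`.
    · have hact := activeGain_ge hG hm hC (c := f (level I.graph x' w)) fun z hz hlt =>
        hG.strictMono.monotone (hm.lowest z hz ((hm.lt_iff hC hz).1 hlt) w hwC)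
      rw [hfull] at hact
      have hdv : dualUpdate I.graph v (I.available i v) F x x' α v =
        α v + activeGain I.graph (I.available i v) F x x' := if_pos rfl
      rcases lt_trichotomy (I.arrivalTime w) (I.arrivalTime v) with hlt | heq | hlt
      · have h1 := hI.active v w hvw hlt (by omega) hu.ge hw
        have h2 := hG.le_of_earlier (hI.base_le v) (hI.base_nonneg v) hb
          (by linarith [hG.strictMono.monotone (hmono w)])
        linarith
      · exact absurd (arrivalTime_injective (I := I) heq) hvw.ne'
      · have h1 := hI.active w v hvw.symm hlt (by omega) hw hu.ge
        have h2 := hG.le_later _ ⟨level_nonneg hI.nonneg v, hI.level_le v⟩ _ hb (a w)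
          ⟨hI.base_nonneg w, (hI.base_le w).trans (hmono w)⟩ h1
        linarith
    · rw [hfull w hwC] at hgw
      linarith [hG.le_full]

theorem DualInvariant.step (hG : GainSharing f F Γ) (hI : I.DualInvariant f F Γ i.val x α a)
    (h : I.EagerStep f i x x') : ∃ α' a', I.DualInvariant f F Γ (i.val + 1) x' α' a' := by
  rcases hi : I.event i with u | u
  · exact hI.arrival hG hi ((eagerStep_arrival_iff hi).1 h)
  · exact hI.deadline hG hi ((eagerStep_deadline_iff hi).1 h)

theorem exists_isEagerOutput (hf : StrictMono f) (hfc : Continuous f) (f0 : f 0 = 0)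
    (f1 : f 1 = 1) : ∃ x, I.IsEagerOutput f x := by
  classical
  have hex : ∀ (k : ℕ) (x : {x : Sym2 V → ℝ // (∀ e, 0 ≤ x e) ∧ ∀ v, level I.graph x v ≤ 1}),
      ∃ x' : {x : Sym2 V → ℝ // (∀ e, 0 ≤ x e) ∧ ∀ v, level I.graph x v ≤ 1},
        ∀ hk : k < 2 * Fintype.card V, I.EagerStep f ⟨k, hk⟩ x.1 x'.1 := by
    intro k x
    by_cases hk : k < 2 * Fintype.card V
    · obtain ⟨x', hx'⟩ := exists_eagerStep (i := ⟨k, hk⟩) hf hfc f0 f1 x.2.1 x.2.2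
      exact ⟨⟨x', hx'.feasible x.2.1 x.2.2⟩, fun _ => hx'⟩
    -- Past the last event the state is simply kept.
    · exact ⟨x, fun h => absurd h hk⟩
  choose next hnext using hex
  let X : ℕ → {x : Sym2 V → ℝ // (∀ e, 0 ≤ x e) ∧ ∀ v, level I.graph x v ≤ 1} :=
    fun k => Nat.rec ⟨0, fun _ => le_rfl, fun v => by simp [level]⟩ next k
  exact ⟨_, fun i => (X i.val).1, rfl, fun i => hnext i.val (X i.val) i.isLt, rfl⟩

theorem IsEagerOutput.unique (hf : StrictMono f) (hfc : Continuous f)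
    (h₁ : I.IsEagerOutput f x₁) (h₂ : I.IsEagerOutput f x₂) : x₁ = x₂ := by
  obtain ⟨X, hX0, hX, rfl⟩ := h₁
  obtain ⟨Y, hY0, hY, rfl⟩ := h₂
  have key : ∀ i, X i = Y i := by
    intro i
    induction i using Fin.induction with
    | zero => rw [hX0, hY0]
    | succ i ih => exact (hX i).unique hf hfc (ih ▸ hY i)
  exact key _

theorem IsEagerOutput.dualInvariant (hG : GainSharing f F Γ) (h : I.IsEagerOutput f x) :
    ∃ α a, I.DualInvariant f F Γ (2 * Fintype.card V) x α a := by
  obtain ⟨X, hX0, hX, rfl⟩ := h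
  have key : ∀ i, ∃ α a, I.DualInvariant f F Γ i.val (X i) α a := by
    intro i
    induction i using Fin.induction with
    | zero => exact ⟨0, 0, hX0 ▸ dualInvariant_zero⟩
    | succ i ih =>
      obtain ⟨α, a, hI⟩ := ih
      exact hI.step hG (hX i)
  exact key (Fin.last _)

end Instance

theorem GainSharing.isCompetitive (hG : GainSharing f F Γ) :
    EagerWaterFillingIsCompetitive.{u} f Γ := by
  intro V _ I
  obtain ⟨x, hx⟩ := I.exists_isEagerOutput hG.strictMono hG.continuous hG.f_zero hG.f_one
  refine ⟨⟨x, hx, fun y hy => hy.unique hG.strictMono hG.continuous hx⟩, fun y hy => ?_⟩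
  obtain ⟨α, a, hI⟩ := hy.dualInvariant hG
  refine ⟨⟨fun e _ => hI.nonneg e, hI.level_le⟩, fun z hz => ?_⟩
  rw [← hI.sum_dual]
  exact mul_size_le_of_cover hI.dual_nonneg
    (fun v w hvw => hI.cover v w hvw (I.event.symm (.deadline v)).isLt) hz

end Analysis

/-! ### The piecewise linear function and its quadratic inequalities -/

section Numerics

/-- The ramp from `0` at `a` to `b - a` at `b`. -/
noncomputable def ramp (a b t : ℝ) : ℝ := max 0 (t - a) - max 0 (t - b)

/-- A primitive of `ramp a b`. -/
noncomputable def rampPrimitive (a b t : ℝ) : ℝ := (max 0 (t - a) ^ 2 - max 0 (t - b) ^ 2) / 2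

theorem ramp_of_le {a b t : ℝ} (hab : a ≤ b) (h : t ≤ a) :
    ramp a b t = 0 ∧ rampPrimitive a b t = 0 := by
  rw [ramp, rampPrimitive, max_eq_left (by linarith), max_eq_left (by linarith)]
  norm_num

theorem ramp_of_mem {a b t : ℝ} (h1 : a ≤ t) (h2 : t ≤ b) :
    ramp a b t = t - a ∧ rampPrimitive a b t = (t - a) ^ 2 / 2 := by
  rw [ramp, rampPrimitive, max_eq_right (by linarith), max_eq_left (by linarith)]
  constructor <;> ring

theorem ramp_of_ge {a b t : ℝ} (hab : a ≤ b) (h : b ≤ t) :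
    ramp a b t = b - a ∧ rampPrimitive a b t = (b - a) * (t - (a + b) / 2) := by
  rw [ramp, rampPrimitive, max_eq_right (by linarith), max_eq_right (by linarith)]
  constructor <;> ring

theorem ramp_mono {a b : ℝ} (hab : a ≤ b) : Monotone (ramp a b) := by
  intro s t hst
  rcases le_total s a with hs | hs
  · rw [(ramp_of_le hab hs).1, ramp, sub_nonneg]
    exact max_le_max le_rfl (by linarith)
  rcases le_total b t with ht | ht
  · rw [(ramp_of_ge hab ht).1]
    rcases le_total s b with hs' | hs'
    · rw [(ramp_of_mem hs hs').1]
      linarith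
    · rw [(ramp_of_ge hab hs').1]
  · rw [(ramp_of_mem hs (hst.trans ht)).1, (ramp_of_mem (hs.trans hst) ht).1]
    linarith

/-- Tangent inequality of a convex function; nonnegative combinations pass it on to
`waterLevelPrimitive`. -/
theorem ramp_mul_le {a b : ℝ} (hab : a ≤ b) (s t : ℝ) :
    (s - t) * ramp a b t ≤ rampPrimitive a b s - rampPrimitive a b t := by
  rcases le_total s a with hs | hs
  · obtain ⟨-, h2⟩ := ramp_of_le hab hs
    rw [h2]
    rcases le_total t a with ht | ht
    · obtain ⟨h3, h4⟩ := ramp_of_le hab ht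
      rw [h3, h4]
      linarith
    rcases le_total t b with ht' | ht'
    · obtain ⟨h3, h4⟩ := ramp_of_mem ht ht'
      rw [h3, h4]
      nlinarith
    · obtain ⟨h3, h4⟩ := ramp_of_ge hab ht'
      rw [h3, h4]
      nlinarith
  rcases le_total s b with hs' | hs'
  · obtain ⟨-, h2⟩ := ramp_of_mem hs hs'
    rw [h2]
    rcases le_total t a with ht | ht
    · obtain ⟨h3, h4⟩ := ramp_of_le hab ht
      rw [h3, h4]
      nlinarith
    rcases le_total t b with ht' | ht'
    · obtain ⟨h3, h4⟩ := ramp_of_mem ht ht'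
      rw [h3, h4]
      nlinarith [sq_nonneg (s - t)]
    · obtain ⟨h3, h4⟩ := ramp_of_ge hab ht'
      rw [h3, h4]
      nlinarith [sq_nonneg (s - b)]
  · obtain ⟨-, h2⟩ := ramp_of_ge hab hs'
    rw [h2]
    rcases le_total t a with ht | ht
    · obtain ⟨h3, h4⟩ := ramp_of_le hab ht
      rw [h3, h4]
      nlinarith
    rcases le_total t b with ht' | ht'
    · obtain ⟨h3, h4⟩ := ramp_of_mem ht ht'
      rw [h3, h4]
      nlinarith [mul_nonneg (sub_nonneg.2 ht') (sub_nonneg.2 hs'), sq_nonneg (t - b)]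
    · obtain ⟨h3, h4⟩ := ramp_of_ge hab ht'
      rw [h3, h4]
      nlinarith

theorem continuous_ramp (a b : ℝ) : Continuous (ramp a b) := by
  unfold ramp
  fun_prop

/-- The water level as a function of the price: on `[0, 1]` it is piecewise linear with kinks at
`1/4`, `107/200` and `3/4`. -/
noncomputable def waterLevel (t : ℝ) : ℝ :=
  1 / 1000 * t + 1139 / 1000 * ramp (1 / 4) (107 / 200) t +
    1799 / 1000 * ramp (107 / 200) (3 / 4) t + 719 / 625 * ramp (3 / 4) 1 t

/-- A primitive of `waterLevel`. -/
noncomputable def waterLevelPrimitive (t : ℝ) : ℝ :=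
  1 / 2000 * t ^ 2 + 1139 / 1000 * rampPrimitive (1 / 4) (107 / 200) t +
    1799 / 1000 * rampPrimitive (107 / 200) (3 / 4) t + 719 / 625 * rampPrimitive (3 / 4) 1 t

theorem waterLevel_strictMono : StrictMono waterLevel := by
  intro s t hst
  have h1 := ramp_mono (a := 1 / 4) (b := 107 / 200) (by norm_num) hst.le
  have h2 := ramp_mono (a := 107 / 200) (b := 3 / 4) (by norm_num) hst.le
  have h3 := ramp_mono (a := 3 / 4) (b := 1) (by norm_num) hst.le
  unfold waterLevel
  linarith

theorem continuous_waterLevel : Continuous waterLevel := by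
  unfold waterLevel
  have := continuous_ramp
  fun_prop

theorem waterLevel_mul_le (s t : ℝ) :
    (s - t) * waterLevel t ≤ waterLevelPrimitive s - waterLevelPrimitive t := by
  have h1 := ramp_mul_le (a := 1 / 4) (b := 107 / 200) (by norm_num) s t
  have h2 := ramp_mul_le (a := 107 / 200) (b := 3 / 4) (by norm_num) s t
  have h3 := ramp_mul_le (a := 3 / 4) (b := 1) (by norm_num) s t
  unfold waterLevel waterLevelPrimitive
  nlinarith [sq_nonneg (s - t)]

theorem waterLevel_of_le_quarter {t : ℝ} (h : t ≤ 1 / 4) :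
    waterLevel t = 1 / 1000 * t ∧ waterLevelPrimitive t = 1 / 2000 * t ^ 2 := by
  obtain ⟨a1, b1⟩ := ramp_of_le (a := 1 / 4) (b := 107 / 200) (t := t) (by norm_num) h
  obtain ⟨a2, b2⟩ := ramp_of_le (a := 107 / 200) (b := 3 / 4) (t := t) (by norm_num) (by linarith)
  obtain ⟨a3, b3⟩ := ramp_of_le (a := 3 / 4) (b := 1) (t := t) (by norm_num) (by linarith)
  rw [waterLevel, waterLevelPrimitive, a1, b1, a2, b2, a3, b3]
  constructor <;> ring

theorem waterLevel_of_le_middle {t : ℝ} (h0 : 1 / 4 ≤ t) (h : t ≤ 107 / 200) :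
    waterLevel t = 57 / 50 * t - 1139 / 4000 ∧
      waterLevelPrimitive t = 57 / 100 * t ^ 2 - 1139 / 4000 * t + 1139 / 32000 := by
  obtain ⟨a1, b1⟩ := ramp_of_mem (a := 1 / 4) (b := 107 / 200) (t := t) h0 h
  obtain ⟨a2, b2⟩ := ramp_of_le (a := 107 / 200) (b := 3 / 4) (t := t) (by norm_num) h
  obtain ⟨a3, b3⟩ := ramp_of_le (a := 3 / 4) (b := 1) (t := t) (by norm_num) (by linarith)
  rw [waterLevel, waterLevelPrimitive, a1, b1, a2, b2, a3, b3]
  constructor <;> ring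

theorem waterLevel_of_le_three_quarters {t : ℝ} (h0 : 107 / 200 ≤ t) (h : t ≤ 3 / 4) :
    waterLevel t = 9 / 5 * t - 12757 / 20000 ∧
      waterLevelPrimitive t = 9 / 10 * t ^ 2 - 12757 / 20000 * t + 2032 / 15625 := by
  obtain ⟨a1, b1⟩ := ramp_of_ge (a := 1 / 4) (b := 107 / 200) (t := t) (by norm_num) h0
  obtain ⟨a2, b2⟩ := ramp_of_mem (a := 107 / 200) (b := 3 / 4) (t := t) h0 h
  obtain ⟨a3, b3⟩ := ramp_of_le (a := 3 / 4) (b := 1) (t := t) (by norm_num) h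
  rw [waterLevel, waterLevelPrimitive, a1, b1, a2, b2, a3, b3]
  constructor <;> ring

theorem waterLevel_of_le_one {t : ℝ} (h0 : 3 / 4 ≤ t) (h : t ≤ 1) :
    waterLevel t = 5757 / 5000 * t - 757 / 5000 ∧
      waterLevelPrimitive t = 5757 / 10000 * t ^ 2 - 757 / 5000 * t - 209483 / 4000000 := by
  obtain ⟨a1, b1⟩ := ramp_of_ge (a := 1 / 4) (b := 107 / 200) (t := t) (by norm_num) (by linarith)
  obtain ⟨a2, b2⟩ := ramp_of_ge (a := 107 / 200) (b := 3 / 4) (t := t) (by norm_num) h0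
  obtain ⟨a3, b3⟩ := ramp_of_mem (a := 3 / 4) (b := 1) (t := t) h0 h
  rw [waterLevel, waterLevelPrimitive, a1, b1, a2, b2, a3, b3]
  constructor <;> ring

/-- This is `le_earlier` with `t = f b`. -/
theorem earlier_bound {t : ℝ} (h1 : t ≤ 1) :
    0.592 ≤ 1 - t + (t * waterLevel t - waterLevelPrimitive t) := by
  rcases le_total t (1 / 4) with h | h
  · obtain ⟨e1, e2⟩ := waterLevel_of_le_quarter h
    rw [e1, e2]
    nlinarith
  rcases le_total t (107 / 200) with h' | h'
  · obtain ⟨e1, e2⟩ := waterLevel_of_le_middle h h'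
    rw [e1, e2]
    nlinarith
  rcases le_total t (3 / 4) with h'' | h''
  · obtain ⟨e1, e2⟩ := waterLevel_of_le_three_quarters h' h''
    rw [e1, e2]
    -- The slope is `9 / 5` here, so the minimum is at `5 / 9`; its value is about 0.59217.
    nlinarith [sq_nonneg (t - 5 / 9)]
  · obtain ⟨e1, e2⟩ := waterLevel_of_le_one h'' h1
    rw [e1, e2]
    nlinarith [sq_nonneg (t - 3 / 4)]

/-- This is `le_later` with `s = f p` and `t = f b`, the price `f a` being lowered to `1 - s`. The
splits at `1 / 4`, `93 / 200`, `107 / 200` and `3 / 4` fix the linear piece of both `s` and `1 - s`.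
-/
theorem later_bound {s t : ℝ} (hs0 : 0 ≤ s) (hs1 : s ≤ 1) (ht1 : t ≤ 1) (hst : 1 ≤ s + t) :
    0.592 ≤ (s * waterLevel s - waterLevelPrimitive s) + waterLevelPrimitive (1 - s) +
      (1 - waterLevel s) * (1 - t) + (t * waterLevel t - waterLevelPrimitive t) := by
  have ht0 : 0 ≤ t := by linarith
  rcases le_total s (1 / 4) with hs | hs
  · rw [(waterLevel_of_le_quarter hs).1, (waterLevel_of_le_quarter hs).2,
      (waterLevel_of_le_one (t := 1 - s) (by linarith) (by linarith)).2,
      (waterLevel_of_le_one (t := t) (by linarith) (by linarith)).1,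
      (waterLevel_of_le_one (t := t) (by linarith) (by linarith)).2]
    nlinarith [mul_nonneg hs0 (sub_nonneg.2 ht1), sq_nonneg (t - 3 / 4)]
  rcases le_total s (93 / 200) with hs' | hs'
  · rw [(waterLevel_of_le_middle hs (by linarith)).1, (waterLevel_of_le_middle hs (by linarith)).2,
      (waterLevel_of_le_three_quarters (t := 1 - s) (by linarith) (by linarith)).2]
    rcases le_total t (3 / 4) with ht | ht
    · obtain ⟨e1, e2⟩ := waterLevel_of_le_three_quarters (t := t) (by linarith) ht
      rw [e1, e2]
      nlinarith [mul_nonneg (sub_nonneg.2 hs) (sub_nonneg.2 hst), sq_nonneg (s + t - 1)]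
    · obtain ⟨e1, e2⟩ := waterLevel_of_le_one (t := t) ht ht1
      rw [e1, e2]
      nlinarith [mul_nonneg (sub_nonneg.2 hs) (sub_nonneg.2 ht), sq_nonneg (s + t - 1)]
  rcases le_total s (107 / 200) with hs'' | hs''
  · rw [(waterLevel_of_le_middle hs hs'').1, (waterLevel_of_le_middle hs hs'').2,
      (waterLevel_of_le_middle (t := 1 - s) (by linarith) (by linarith)).2]
    rcases le_total t (107 / 200) with ht | ht
    · obtain ⟨e1, e2⟩ := waterLevel_of_le_middle (t := t) (by linarith) ht
      rw [e1, e2]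
      nlinarith [mul_nonneg (sub_nonneg.2 hs) (sub_nonneg.2 hst), sq_nonneg (s + t - 1)]
    rcases le_total t (3 / 4) with ht' | ht'
    · obtain ⟨e1, e2⟩ := waterLevel_of_le_three_quarters (t := t) (by linarith) ht'
      rw [e1, e2]
      nlinarith [mul_nonneg (sub_nonneg.2 hs) (sub_nonneg.2 ht), sq_nonneg (s + t - 1)]
    · obtain ⟨e1, e2⟩ := waterLevel_of_le_one (t := t) ht' ht1
      rw [e1, e2]
      nlinarith [mul_nonneg (sub_nonneg.2 hs) (sub_nonneg.2 ht'), sq_nonneg (s + t - 1)]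
  rcases le_total s (3 / 4) with hs3 | hs3
  · rw [(waterLevel_of_le_three_quarters hs'' hs3).1, (waterLevel_of_le_three_quarters hs'' hs3).2,
      (waterLevel_of_le_middle (t := 1 - s) (by linarith) (by linarith)).2]
    rcases le_total t (107 / 200) with ht | ht
    · obtain ⟨e1, e2⟩ := waterLevel_of_le_middle (t := t) (by linarith) ht
      rw [e1, e2]
      -- The tightest case, with slack below `1 / 10000`. The first square vanishes where the
      -- expression is stationary in `t`; the second is centered near the minimizer of the remaining
      -- quadratic in `s`.
      nlinarith [sq_nonneg (t + 90/57 * s - 163785/114000), sq_nonneg (s - 687/1000)]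
    rcases le_total t (3 / 4) with ht' | ht'
    · obtain ⟨e1, e2⟩ := waterLevel_of_le_three_quarters (t := t) (by linarith) ht'
      rw [e1, e2]
      -- The minimum lies on the edge `t = 107 / 200`, near `s = 144 / 250`.
      nlinarith [mul_nonneg (sub_nonneg.2 hs'') (sub_nonneg.2 ht), sq_nonneg (t - 107 / 200),
        sq_nonneg (s - 144 / 250)]
    · obtain ⟨e1, e2⟩ := waterLevel_of_le_one (t := t) ht' ht1
      rw [e1, e2]
      nlinarith [mul_nonneg (sub_nonneg.2 hs'') (sub_nonneg.2 ht'), sq_nonneg (s + t - 1)]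
  · rw [(waterLevel_of_le_one hs3 hs1).1, (waterLevel_of_le_one hs3 hs1).2,
      (waterLevel_of_le_quarter (t := 1 - s) (by linarith)).2]
    rcases le_total t (1 / 4) with ht | ht
    · obtain ⟨e1, e2⟩ := waterLevel_of_le_quarter (t := t) ht
      rw [e1, e2]
      nlinarith [mul_nonneg (sub_nonneg.2 hs1) (sub_nonneg.2 ht), sq_nonneg (s - 3 / 4)]
    rcases le_total t (107 / 200) with ht' | ht'
    · obtain ⟨e1, e2⟩ := waterLevel_of_le_middle (t := t) ht ht'
      rw [e1, e2]
      -- Nearly tight close to the corner `s = 3 / 4`, `t = 1 / 4`.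
      nlinarith [mul_nonneg (sub_nonneg.2 hs3) (sub_nonneg.2 ht), sq_nonneg (t - 101 / 400),
        sq_nonneg (s - 1501 / 2000)]
    rcases le_total t (3 / 4) with ht3 | ht3
    · obtain ⟨e1, e2⟩ := waterLevel_of_le_three_quarters (t := t) ht' ht3
      rw [e1, e2]
      nlinarith [mul_nonneg (sub_nonneg.2 hs3) (sub_nonneg.2 ht'), sq_nonneg (s + t - 1)]
    · obtain ⟨e1, e2⟩ := waterLevel_of_le_one (t := t) ht3 ht1
      rw [e1, e2]
      nlinarith [mul_nonneg (sub_nonneg.2 hs3) (sub_nonneg.2 ht3), sq_nonneg (s + t - 1)]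

end Numerics

/-! ### The inverse function and its gain-sharing conditions -/

theorem waterLevel_zero : waterLevel 0 = 0 := by
  rw [(waterLevel_of_le_quarter (by norm_num)).1, mul_zero]

theorem waterLevel_one : waterLevel 1 = 1 := by
  rw [(waterLevel_of_le_one (by norm_num) le_rfl).1]
  norm_num

/-- The linear term with slope `1 / 1000` makes the function unbounded in both directions. -/
theorem waterLevel_surjective : Function.Surjective waterLevel := by
  have hb : ∀ s t, s ≤ t → (t - s) / 1000 ≤ waterLevel t - waterLevel s := by
    intro s t hst
    have h1 := ramp_mono (a := 1 / 4) (b := 107 / 200) (by norm_num) hst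
    have h2 := ramp_mono (a := 107 / 200) (b := 3 / 4) (by norm_num) hst
    have h3 := ramp_mono (a := 3 / 4) (b := 1) (by norm_num) hst
    unfold waterLevel
    linarith
  intro y
  have h1 := hb 0 (1000 * |y|) (by positivity)
  have h2 := hb (-(1000 * |y|)) 0 (by linarith [abs_nonneg y])
  rw [waterLevel_zero] at h1 h2
  exact mem_range_of_exists_le_of_exists_ge continuous_waterLevel
    ⟨_, by linarith [neg_abs_le y]⟩ ⟨1000 * |y|, by linarith [le_abs_self y]⟩

/-- `waterLevel` as an order isomorphism of the real line. -/
noncomputable def waterLevelIso : ℝ ≃o ℝ :=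
  waterLevel_strictMono.orderIsoOfSurjective waterLevel waterLevel_surjective

/-- The price of a vertex as a function of its water level. -/
noncomputable def price (a : ℝ) : ℝ := waterLevelIso.symm a

theorem waterLevel_price (a : ℝ) : waterLevel (price a) = a :=
  waterLevelIso.apply_symm_apply a

theorem price_waterLevel (t : ℝ) : price (waterLevel t) = t :=
  waterLevelIso.symm_apply_apply t

theorem price_strictMono : StrictMono price := waterLevelIso.symm.strictMono

theorem continuous_price : Continuous price := waterLevelIso.symm.continuous

theorem price_zero : price 0 = 0 := by
  simpa [waterLevel_zero] using price_waterLevel 0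

theorem price_one : price 1 = 1 := by
  simpa [waterLevel_one] using price_waterLevel 1

/-- A primitive of `price`, by Young's identity. -/
noncomputable def pricePrimitive (a : ℝ) : ℝ := a * price a - waterLevelPrimitive (price a)

theorem price_mem {a : ℝ} (h : a ∈ Set.Icc (0 : ℝ) 1) : 0 ≤ price a ∧ price a ≤ 1 :=
  ⟨price_zero ▸ price_strictMono.monotone h.1, price_one ▸ price_strictMono.monotone h.2⟩

theorem waterLevelPrimitive_mono {s t : ℝ} (hs : 0 ≤ s) (hst : s ≤ t) :
    waterLevelPrimitive s ≤ waterLevelPrimitive t := by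
  have h1 := waterLevel_mul_le t s
  have h2 := waterLevel_strictMono.monotone hs
  rw [waterLevel_zero] at h2
  nlinarith

theorem gainSharing_price : GainSharing price pricePrimitive 0.592 where
  strictMono := price_strictMono
  continuous := continuous_price
  f_zero := price_zero
  f_one := price_one
  F_zero := by
    rw [pricePrimitive, price_zero, (waterLevel_of_le_quarter (by norm_num)).2]
    norm_num
  mul_le_sub a b := by
    -- Convex duality: the tangent inequality of `H` at `f b` is the one of `F` at `a`.
    have h := waterLevel_mul_le (price a) (price b)
    rw [waterLevel_price] at h
    rw [pricePrimitive, pricePrimitive]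
    linarith
  le_full := by
    rw [pricePrimitive, price_one, (waterLevel_of_le_one (by norm_num) le_rfl).2]
    norm_num
  le_earlier b hb := by
    have h := earlier_bound (price_mem hb).2
    rw [waterLevel_price] at h
    rw [pricePrimitive]
    linarith
  le_later p hp b hb a ha hap := by
    have hp' := price_mem hp
    have hab := price_strictMono.monotone ha.2
    have h := later_bound hp'.1 hp'.2 (price_mem hb).2 (by linarith)
    -- The term `a * f a - F a` equals `H (f a)`, which is smallest at `f a = 1 - f p`.
    have hH := waterLevelPrimitive_mono (s := 1 - price p) (t := price a) (by linarith) (by linarith)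
    rw [waterLevel_price, waterLevel_price] at h
    simp only [pricePrimitive]
    linarith

end FullyOnline

theorem theorem2 :
    ∃ h f : ℝ → ℝ,
      StrictMonoOn h (Set.Icc 0 1) ∧ ContinuousOn h (Set.Icc 0 1) ∧ h 0 = 0 ∧ h 1 = 1 ∧
      Set.InvOn f h (Set.Icc 0 1) (Set.Icc 0 1) ∧
      FullyOnline.EagerWaterFillingIsCompetitive.{u} f 0.592 :=
  ⟨FullyOnline.waterLevel, FullyOnline.price, FullyOnline.waterLevel_strictMono.strictMonoOn _,
    FullyOnline.continuous_waterLevel.continuousOn, FullyOnline.waterLevel_zero,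
    FullyOnline.waterLevel_one,
    ⟨fun t _ => FullyOnline.price_waterLevel t, fun a _ => FullyOnline.waterLevel_price a⟩,
    FullyOnline.gainSharing_price.isCompetitive⟩
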